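/- Let $\mathcal H$ be a real Hilbert space and let $\Gamma_0(\mathcal H)$ denote the set of proper, convex, lower semicontinuous functions $\mathcal H\to\mathbb R\cup\{+\infty\}$. For $f\in\Gamma_0(\mathcal H)$ let $$f^*(p)=\sup_{v\in\mathcal H}\{\langle p,v\rangle-f(v)\},\qquad \operatorname{prox}_f(x)=\operatorname*{argmin}_{y\in\mathcal H}\Big\{f(y)+\tfrac12\|x-y\|^2\Big\},$$ $$\partial f(x)=\{p\in\mathcal H:\ f(x)+\langle p,y-x\rangle\le f(y)\ \text{ for all } y\in\mathcal H\},$$ and let $\partial f(x)^\circ=\operatorname{Proj}_{\partial f(x)}(0)$ be the element of minimal norm of $\partial f(x)$, regarded as a singleton, with $\partial f(x)^\circ=\emptyset$ if $\partial f(x)=\emptyset$. Let $f,g\in\Gamma_0(\mathcal H)$ be such that $f^*$ and $g^*$ are bounded from below. Then the following assertions are equivalent: (i) $\|\operatorname{prox}_f(x)\|=\|\operatorname{prox}_g(x)\|$ for all $x\in\mathcal H$. (ii) $f(x)=g(x)+\inf g^*-\inf f^*$ for all $x\in\mathcal H$. (iii) $\partial f(x)^\circ=\partial g(x)^\circ$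 for all $x\in\mathcal H$. (iv) $\partial f(x)=\partial g(x)$ for all $x\in\mathcal H$. (v) $\operatorname{prox}_f(x)=\operatorname{prox}_g(x)$ for all $x\in\mathcal H$. -/

import Mathlib

noncomputable section

namespace HilbertConvex

variable {H : Type*} [NormedAddCommGroup H] [InnerProductSpace ℝ H]

/-- The class `Γ₀(H)` of proper, convex, lower semicontinuous functions on `H` with values in
`ℝ ∪ {+∞}`, modelled as `EReal`-valued functions that never take the value `⊥`. -/
structure IsGammaZero (f : H → EReal) : Prop where
  ne_bot : ∀ x, f x ≠ ⊥
  exists_ne_top : ∃ x, f x ≠ ⊤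
  convex : ∀ (x y : H) (a b : ℝ), 0 < a → 0 < b → a + b = 1 →
    f (a • x + b • y) ≤ (a : EReal) * f x + (b : EReal) * f y
  lsc : LowerSemicontinuous f

/-- The Legendre-Fenchel conjugate `f*(p) = sup_v (⟨p, v⟩ - f v)`. -/
def conj (f : H → EReal) (p : H) : EReal :=
  ⨆ v : H, ((inner ℝ p v : ℝ) : EReal) - f v

/-- `f` is bounded from below by a real constant. -/
def BoundedFromBelow (f : H → EReal) : Prop :=
  ∃ m : ℝ, ∀ x, (m : EReal) ≤ f x

/-- The objective `y ↦ f y + ‖x - y‖² / 2` of the proximal problem at `x`. -/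
def proxObjective (f : H → EReal) (x y : H) : EReal :=
  f y + ((‖x - y‖ ^ 2 / 2 : ℝ) : EReal)

open Classical in
/-- The proximal operator: `prox f x` is the minimizer over `H` of `y ↦ f y + ‖x - y‖² / 2`.
For `f ∈ Γ₀(H)`, with `H` complete, there is exactly one minimizer; the value `0` is used
only where there is none. -/
def prox (f : H → EReal) (x : H) : H :=
  if h : ∃ p, ∀ y, proxObjective f x p ≤ proxObjective f x y then h.choose else 0

/-- The convex subdifferential `∂f(x) = {p | ∀ y, f x + ⟨p, y - x⟩ ≤ f y}`.
For proper `f` it is empty where `f x = ⊤`. -/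
def subdiff (f : H → EReal) (x : H) : Set H :=
  {p | ∀ y, f x + ((inner ℝ p (y - x) : ℝ) : EReal) ≤ f y}

/-- The set-valued metric projection: the points of `C` nearest to `x`. It is empty for `C = ∅` and
a singleton for a nonempty closed convex subset `C` of a Hilbert space. -/
def proj (C : Set H) (x : H) : Set H :=
  {p | p ∈ C ∧ ∀ q ∈ C, ‖x - p‖ ≤ ‖x - q‖}

/-- The minimal section `∂f(x)° = Proj_{∂f(x)}(0)`: the set whose only element is the subgradient of
minimal norm if `∂f(x)` is nonempty, and the empty set if `∂f(x)` is empty. -/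
def minSubgrad (f : H → EReal) (x : H) : Set H :=
  proj (subdiff f x) 0

end HilbertConvex

end

/-!
Let `f` and `g` be in `Γ₀(H)`. The proof that the norm of the proximal operator determines `f` up to
a constant compares the convex potentials `F`, `G` of `prox f`, `prox g` (`proxPotential`: the Moreau
envelopes of the conjugates). They satisfy `∇F = prox f`, `∇G = prox g` and `inf F = inf f*`,
`inf G = inf g*`, so both are bounded from below and `‖∇F‖ = ‖∇G‖`. Along a gradient descent of `G`
with small step size, `F` cannot decrease faster than `G`, up to a vanishing error, since
`⟪∇F, ∇G⟫ ≤ ‖∇G‖ ^ 2`; and the values of `F` there tend to `inf F`, because the squared gradient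
norms are summable and decreasing. Hence `F - inf F ≤ G - inf G`
(`sub_le_sub_of_norm_subgradient_eq`), and equality follows by symmetry. Then the gradients `prox f`
and `prox g` agree, `f - g` is the expected constant on the domain of the subdifferential, and the
resolvents carry this over to the whole space (`IsGammaZero.eq_add_of_norm_prox_eq`).

The minimal section determines the subdifferential by an argument from the theory of maximal monotone
operators (`IsGammaZero.mem_subdiff_of_forall_minSubgrad`): a vector `y` monotonically related at
`x ∈ dom ∂f` to the minimal section of `∂f` coincides with its own projection onto `∂f x`, as seen by
passing to the limit in resolvents of `∂f - y` at `x`. The subdifferential and the proximal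
operator determine each other through `prox f x = p ↔ x - p ∈ ∂f p`. The resolvents exist by strong
convexity and completeness (`IsGammaZero.exists_smul_sub_mem_subdiff`).
-/

namespace HilbertConvex

variable {H : Type*} [NormedAddCommGroup H] [InnerProductSpace ℝ H] {f g : H → EReal}

/-! ### Real values and subgradients of functions in `Γ₀(H)` -/

theorem IsGammaZero.coe_toReal (hf : IsGammaZero f) {x : H} (hx : f x ≠ ⊤) :
    ((f x).toReal : EReal) = f x :=
  EReal.coe_toReal hx (hf.ne_bot x)

theorem IsGammaZero.convex_toReal (hf : IsGammaZero f) {x y : H} (hx : f x ≠ ⊤) (hy : f y ≠ ⊤)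
    {a b : ℝ} (ha : 0 < a) (hb : 0 < b) (hab : a + b = 1) :
    f (a • x + b • y) ≠ ⊤ ∧
      (f (a • x + b • y)).toReal ≤ a * (f x).toReal + b * (f y).toReal := by
  have h := hf.convex x y a b ha hb hab
  rw [← hf.coe_toReal hx, ← hf.coe_toReal hy] at h
  norm_cast at h
  have hne : f (a • x + b • y) ≠ ⊤ := fun h' => by
    rw [h', top_le_iff] at h
    exact EReal.coe_ne_top _ h
  refine ⟨hne, ?_⟩
  rw [← hf.coe_toReal hne] at h
  exact_mod_cast h

theorem IsGammaZero.mem_subdiff_iff (hf : IsGammaZero f) {p x : H} :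
    p ∈ subdiff f x ↔ f x ≠ ⊤ ∧
      ∀ y, f y ≠ ⊤ → (f x).toReal + inner ℝ p (y - x) ≤ (f y).toReal := by
  constructor
  · intro h
    have hx : f x ≠ ⊤ := by
      obtain ⟨y, hy⟩ := hf.exists_ne_top
      intro hx
      have := h y
      rw [hx, EReal.top_add_coe, top_le_iff] at this
      exact hy this
    refine ⟨hx, fun y hy => ?_⟩
    have := h y
    rw [← hf.coe_toReal hx, ← hf.coe_toReal hy] at this
    exact_mod_cast this
  · rintro ⟨hx, h⟩ y
    by_cases hy : f y = ⊤
    · rw [hy]; exact le_top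
    · have := h y hy
      rw [← hf.coe_toReal hx, ← hf.coe_toReal hy]
      exact_mod_cast this

theorem IsGammaZero.subdiff_monotone (hf : IsGammaZero f) {p q x y : H} (hp : p ∈ subdiff f x)
    (hq : q ∈ subdiff f y) : 0 ≤ inner ℝ (p - q) (x - y) := by
  rw [hf.mem_subdiff_iff] at hp hq
  have h1 := hp.2 y hq.1
  have h2 := hq.2 x hp.1
  rw [← neg_sub x y, inner_neg_right] at h1
  rw [inner_sub_left]
  linarith

theorem subdiff_subset_of_eq_add_const {c : ℝ} (h : ∀ x, f x = g x + (c : EReal)) (x : H) :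
    subdiff g x ⊆ subdiff f x := by
  intro p hp y
  rw [h, h, add_right_comm]
  exact add_le_add_left (hp y) _

theorem subdiff_eq_of_eq_add_const {c : ℝ} (h : ∀ x, f x = g x + (c : EReal)) (x : H) :
    subdiff f x = subdiff g x := by
  refine (subdiff_subset_of_eq_add_const (c := -c) (fun x => ?_) x).antisymm
    (subdiff_subset_of_eq_add_const h x)
  rw [h, add_assoc, ← EReal.coe_add, add_neg_cancel, EReal.coe_zero, add_zero]

/-- If `f x ≠ ⊤`, then lower semicontinuity bounds `f` from below near `x`, and convexity
propagates this to a lower bound of linear growth on the whole domain. -/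
theorem IsGammaZero.exists_linear_lower_bound (hf : IsGammaZero f) {x : H} (hx : f x ≠ ⊤) :
    ∃ b : ℝ, 0 ≤ b ∧
      ∀ y, f y ≠ ⊤ → (f x).toReal - 1 - b * ‖y - x‖ ≤ (f y).toReal := by
  have hlt : (((f x).toReal - 1 : ℝ) : EReal) < f x := by
    conv_rhs => rw [← hf.coe_toReal hx]
    exact_mod_cast sub_one_lt _
  obtain ⟨r, hr, hball⟩ := Metric.eventually_nhds_iff.1 (hf.lsc x _ hlt)
  refine ⟨2 / r, by positivity, fun y hy => ?_⟩
  have hnear : ∀ z, f z ≠ ⊤ → ‖z - x‖ < r → (f x).toReal - 1 < (f z).toReal := by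
    intro z hz hzr
    have : _ < f z := hball (y := z) (by rwa [dist_eq_norm])
    rw [← hf.coe_toReal hz] at this
    exact_mod_cast this
  by_cases hyr : ‖y - x‖ < r
  · have := hnear y hy hyr
    have : 0 ≤ 2 / r * ‖y - x‖ := by positivity
    linarith
  · push Not at hyr
    have hpos : 0 < ‖y - x‖ := hr.trans_le hyr
    -- The point of the segment from `x` to `y` at distance `r / 2` from `x` lies in the ball.
    set s := r / (2 * ‖y - x‖) with hs
    have hs0 : 0 < s := by positivity
    have hs1 : s < 1 := by
      rw [hs, div_lt_one (by positivity)]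
      linarith
    have hsn : s * ‖y - x‖ = r / 2 := by rw [hs]; field_simp
    obtain ⟨hz, hle⟩ := hf.convex_toReal hx hy (sub_pos.2 hs1) hs0 (by ring)
    have := hnear _ hz (by
      rw [show (1 - s) • x + s • y - x = s • (y - x) by module, norm_smul,
        Real.norm_of_nonneg hs0.le, hsn]
      linarith)
    have h1 : -1 < s * ((f y).toReal - (f x).toReal) := by linarith
    have h2 : s * (2 / r * ‖y - x‖) = 1 := by
      rw [mul_left_comm, hsn]; field_simp
    have h3 : 0 < s * ((f y).toReal - (f x).toReal + 2 / r * ‖y - x‖) := by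
      rw [mul_add]; linarith
    have := pos_of_mul_pos_right h3 hs0.le
    linarith

/-! ### Resolvents of the subdifferential -/

/-- Solutions of `c • (x - p) ∈ ∂f p` minimize `f + c / 2 * ‖x - ·‖ ^ 2`, with quadratic
growth. -/
theorem IsGammaZero.growth_of_smul_sub_mem_subdiff (hf : IsGammaZero f) {c : ℝ} {x p : H}
    (hp : c • (x - p) ∈ subdiff f p) {y : H} (hy : f y ≠ ⊤) :
    (f p).toReal + c / 2 * ‖x - p‖ ^ 2 + c / 2 * ‖y - p‖ ^ 2 ≤
      (f y).toReal + c / 2 * ‖x - y‖ ^ 2 := by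
  have h := (hf.mem_subdiff_iff.1 hp).2 y hy
  have e : ‖x - y‖ ^ 2 = ‖x - p‖ ^ 2 - 2 * inner ℝ (x - p) (y - p) + ‖y - p‖ ^ 2 := by
    rw [← norm_sub_sq_real, sub_sub_sub_cancel_right]
  rw [real_inner_smul_left] at h
  rw [e]
  linarith

/-- The resolvent of `∂f` is everywhere defined: a minimizing sequence for the strongly convex
function `f + c / 2 * ‖x - ·‖ ^ 2` is Cauchy, and its limit solves the inclusion. -/
theorem IsGammaZero.exists_smul_sub_mem_subdiff [CompleteSpace H] (hf : IsGammaZero f) {c : ℝ}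
    (hc : 0 < c) (x : H) : ∃ p, c • (x - p) ∈ subdiff f p := by
  obtain ⟨x₀, hx₀⟩ := hf.exists_ne_top
  obtain ⟨b, hb, hlow⟩ := hf.exists_linear_lower_bound hx₀
  set V : H → ℝ := fun y => (f y).toReal + c / 2 * ‖x - y‖ ^ 2 with hV
  set S : Set ℝ := V '' {y | f y ≠ ⊤} with hS
  have hne : S.Nonempty := ⟨V x₀, x₀, hx₀, rfl⟩
  have hbdd : BddBelow S := by
    refine ⟨(f x₀).toReal - 1 - b * ‖x - x₀‖ - b ^ 2 / (2 * c), ?_⟩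
    rintro _ ⟨y, hy, rfl⟩
    have h1 := hlow y hy
    have h2 : ‖y - x₀‖ ≤ ‖x - y‖ + ‖x - x₀‖ := by
      rw [norm_sub_rev x y]
      simpa using norm_sub_le_norm_sub_add_norm_sub y x x₀
    have h3 := mul_le_mul_of_nonneg_left h2 hb
    have h4 : 0 ≤ c / 2 * (‖x - y‖ - b / c) ^ 2 := by positivity
    have h5 : c / 2 * (‖x - y‖ - b / c) ^ 2 =
        c / 2 * ‖x - y‖ ^ 2 - b * ‖x - y‖ + b ^ 2 / (2 * c) := by
      field_simp
      ring
    simp only [hV]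
    linarith
  have hinf : ∀ y, f y ≠ ⊤ → sInf S ≤ V y := fun y hy => csInf_le hbdd ⟨y, hy, rfl⟩
  have hseq : ∀ n : ℕ, ∃ y, f y ≠ ⊤ ∧ V y < sInf S + 1 / ((n : ℝ) + 1) := by
    intro n
    obtain ⟨_, ⟨y, hy, rfl⟩, h⟩ := exists_lt_of_csInf_lt hne
      (lt_add_of_pos_right (sInf S) (by positivity : (0 : ℝ) < 1 / ((n : ℝ) + 1)))
    exact ⟨y, hy, h⟩
  choose u hu huV using hseq
  have hlim0 : Filter.Tendsto (fun n : ℕ => 1 / ((n : ℝ) + 1)) Filter.atTop (nhds 0) :=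
    tendsto_one_div_add_atTop_nhds_zero_nat
  have hdist : ∀ m n : ℕ,
      c / 4 * ‖u m - u n‖ ^ 2 ≤ 1 / ((m : ℝ) + 1) + 1 / ((n : ℝ) + 1) := by
    intro m n
    obtain ⟨hz, hle⟩ := hf.convex_toReal (hu m) (hu n) (a := 1 / 2) (b := 1 / 2)
      (by norm_num) (by norm_num) (by norm_num)
    have h1 := hinf _ hz
    have hm := huV m
    have hn := huV n
    have hpar := parallelogram_law_with_norm ℝ (x - u m) (x - u n)
    rw [show x - u m + (x - u n) =
        (2 : ℝ) • (x - ((1 / 2 : ℝ) • u m + (1 / 2 : ℝ) • u n)) by module,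
      show x - u m - (x - u n) = -(u m - u n) by abel, norm_neg, norm_smul,
      Real.norm_of_nonneg (by norm_num : (0 : ℝ) ≤ 2)] at hpar
    simp only [hV] at h1 hm hn
    nlinarith
  have hcauchy : CauchySeq u := by
    rw [Metric.cauchySeq_iff']
    intro ε hε
    obtain ⟨N, hN⟩ := (hlim0.eventually (gt_mem_nhds
      (by positivity : (0 : ℝ) < c / 8 * ε ^ 2))).exists
    refine ⟨N, fun n hn => ?_⟩
    have h1 := hdist n N
    have h2 : 1 / ((n : ℝ) + 1) ≤ 1 / ((N : ℝ) + 1) :=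
      one_div_le_one_div_of_le (by positivity) (by exact_mod_cast Nat.succ_le_succ hn)
    rw [dist_eq_norm]
    refine lt_of_pow_lt_pow_left₀ 2 hε.le ?_
    have h3 : c / 4 * ‖u n - u N‖ ^ 2 < c / 4 * ε ^ 2 := by linarith
    exact lt_of_mul_lt_mul_left h3 (by positivity)
  obtain ⟨p, hp⟩ := cauchySeq_tendsto_of_complete hcauchy
  have hfp : f p ≤ ((sInf S - c / 2 * ‖x - p‖ ^ 2 : ℝ) : EReal) := by
    refine EReal.ge_of_forall_gt_iff_ge.1 fun z hz => ?_
    have hev := hp.eventually (hf.lsc p _ hz)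
    have ht : Filter.Tendsto (fun n : ℕ => sInf S + 1 / ((n : ℝ) + 1) - c / 2 * ‖x - u n‖ ^ 2)
        Filter.atTop (nhds (sInf S + 0 - c / 2 * ‖x - p‖ ^ 2)) :=
      (hlim0.const_add _).sub (((hp.const_sub x).norm.pow 2).const_mul _)
    rw [add_zero] at ht
    have : z ≤ sInf S - c / 2 * ‖x - p‖ ^ 2 := by
      refine ge_of_tendsto ht (hev.mono fun n hn => ?_)
      have hn' : (z : EReal) < f (u n) := hn
      rw [← hf.coe_toReal (hu n), EReal.coe_lt_coe_iff] at hn'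
      have := huV n
      simp only [hV] at this
      linarith
    exact_mod_cast this
  have hpt : f p ≠ ⊤ := ne_top_of_le_ne_top (EReal.coe_ne_top _) hfp
  have hVp : (f p).toReal + c / 2 * ‖x - p‖ ^ 2 ≤ sInf S := by
    rw [← hf.coe_toReal hpt] at hfp
    have : (f p).toReal ≤ sInf S - c / 2 * ‖x - p‖ ^ 2 := by exact_mod_cast hfp
    linarith
  refine ⟨p, hf.mem_subdiff_iff.2 ⟨hpt, fun y hy => ?_⟩⟩
  -- First-order optimality of the minimizer `p` along the segment from `p` to `y`.
  have hstep : ∀ s : ℝ, 0 < s → s < 1 →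
      (f p).toReal + inner ℝ (c • (x - p)) (y - p) ≤
        (f y).toReal + s * (c / 2 * ‖y - p‖ ^ 2) := by
    intro s hs0 hs1
    obtain ⟨hz, hle⟩ := hf.convex_toReal hpt hy (sub_pos.2 hs1) hs0 (by ring)
    have h1 := hVp.trans (hinf _ hz)
    simp only [hV] at h1
    have e : ‖x - ((1 - s) • p + s • y)‖ ^ 2 =
        ‖x - p‖ ^ 2 - 2 * (s * inner ℝ (x - p) (y - p)) + s ^ 2 * ‖y - p‖ ^ 2 := by
      rw [show x - ((1 - s) • p + s • y) = (x - p) - s • (y - p) by module, norm_sub_sq_real,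
        real_inner_smul_right, norm_smul, mul_pow, Real.norm_of_nonneg hs0.le]
    rw [e] at h1
    rw [real_inner_smul_left]
    refine le_of_mul_le_mul_left ?_ hs0
    linarith
  have ht : Filter.Tendsto (fun s : ℝ => (f y).toReal + s * (c / 2 * ‖y - p‖ ^ 2))
      (nhdsWithin 0 (Set.Ioi 0)) (nhds ((f y).toReal + 0 * (c / 2 * ‖y - p‖ ^ 2))) :=
    ((Filter.tendsto_id.mul_const _).const_add _).mono_left nhdsWithin_le_nhds
  rw [zero_mul, add_zero] at ht
  refine ge_of_tendsto ht ?_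
  filter_upwards [Ioo_mem_nhdsGT (zero_lt_one' ℝ)] with s hs
  exact hstep s hs.1 hs.2

theorem IsGammaZero.sub_prox_mem_subdiff [CompleteSpace H] (hf : IsGammaZero f) (x : H) :
    x - prox f x ∈ subdiff f (prox f x) := by
  obtain ⟨p, hp⟩ := hf.exists_smul_sub_mem_subdiff one_pos x
  have hpt := (hf.mem_subdiff_iff.1 hp).1
  have hex : ∃ p, ∀ y, proxObjective f x p ≤ proxObjective f x y := by
    refine ⟨p, fun y => ?_⟩
    by_cases hy : f y = ⊤
    · simp [proxObjective, hy]
    · have h := hf.growth_of_smul_sub_mem_subdiff hp hy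
      have : 0 ≤ ‖y - p‖ ^ 2 := by positivity
      rw [proxObjective, proxObjective, ← hf.coe_toReal hpt, ← hf.coe_toReal hy]
      norm_cast
      linarith
  have hq : ∀ y, proxObjective f x (prox f x) ≤ proxObjective f x y := by
    rw [prox, dif_pos hex]
    exact hex.choose_spec
  have h := hq p
  rw [proxObjective, proxObjective, ← hf.coe_toReal hpt] at h
  have hqt : f (prox f x) ≠ ⊤ := by
    intro h'
    rw [h', EReal.top_add_coe, top_le_iff] at h
    exact absurd h (by exact_mod_cast EReal.coe_ne_top _)
  rw [← hf.coe_toReal hqt] at h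
  norm_cast at h
  have h' := hf.growth_of_smul_sub_mem_subdiff hp hqt
  have h0 : ‖prox f x - p‖ ^ 2 = 0 := le_antisymm (by linarith) (by positivity)
  have : prox f x = p := by simpa [sub_eq_zero] using h0
  rw [this]
  simpa using hp

theorem IsGammaZero.prox_eq_iff [CompleteSpace H] (hf : IsGammaZero f) {x p : H} :
    prox f x = p ↔ x - p ∈ subdiff f p := by
  constructor
  · rintro rfl
    exact hf.sub_prox_mem_subdiff x
  · intro hp
    have h := hf.subdiff_monotone (hf.sub_prox_mem_subdiff x) hp
    rw [sub_sub_sub_cancel_left, ← neg_sub (prox f x) p, inner_neg_left,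
      real_inner_self_eq_norm_sq] at h
    have h0 : ‖prox f x - p‖ ^ 2 = 0 := le_antisymm (by linarith) (by positivity)
    simpa [sub_eq_zero] using h0

theorem IsGammaZero.mem_subdiff_iff_prox [CompleteSpace H] (hf : IsGammaZero f) {x p : H} :
    p ∈ subdiff f x ↔ prox f (x + p) = x := by
  rw [hf.prox_eq_iff, add_sub_cancel_left]

/-- The proximal operator is firmly nonexpansive. -/
theorem IsGammaZero.prox_cocoercive [CompleteSpace H] (hf : IsGammaZero f) (x y : H) :
    ‖prox f x - prox f y‖ ^ 2 ≤ inner ℝ (prox f x - prox f y) (x - y) := by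
  have h := hf.subdiff_monotone (hf.sub_prox_mem_subdiff x) (hf.sub_prox_mem_subdiff y)
  rw [sub_sub_sub_comm, inner_sub_left, real_inner_self_eq_norm_sq, real_inner_comm] at h
  linarith

/-! ### The minimal section determines the subdifferential -/

theorem exists_weak_limit_of_norm_le [CompleteSpace H] {ι : Type*} (U : Ultrafilter ι)
    {u : ι → H} {M : ℝ} (hu : ∀ i, ‖u i‖ ≤ M) :
    ∃ w : H, ∀ v, Filter.Tendsto (fun i => inner ℝ (u i) v) U (nhds (inner ℝ w v)) := by
  have hK := WeakDual.isCompact_closedBall (𝕜 := ℝ) (E := H) 0 M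
  obtain ⟨φ, -, hφ⟩ := hK.ultrafilter_le_nhds
    (U.map fun i => StrongDual.toWeakDual (InnerProductSpace.toDual ℝ H (u i))) (by
      rw [Filter.le_principal_iff]
      refine Filter.mem_map.2 (Filter.univ_mem' fun i => ?_)
      simpa using hu i)
  refine ⟨(InnerProductSpace.toDual ℝ H).symm (WeakDual.toStrongDual φ), fun v => ?_⟩
  have h := ((WeakDual.eval_continuous v).tendsto φ).comp hφ
  rw [InnerProductSpace.toDual_symm_apply]
  exact h

/-- The graph of `∂f` is closed under strong convergence of the points and bounded weak
convergence of the subgradients. -/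
theorem IsGammaZero.mem_subdiff_of_tendsto (hf : IsGammaZero f) {ι : Type*} {l : Filter ι}
    [l.NeBot] {ξ s : ι → H} {x p : H} {M : ℝ} (hs : ∀ i, s i ∈ subdiff f (ξ i))
    (hM : ∀ i, ‖s i‖ ≤ M) (hξ : Filter.Tendsto ξ l (nhds x))
    (hp : ∀ v, Filter.Tendsto (fun i => inner ℝ (s i) v) l (nhds (inner ℝ p v))) :
    p ∈ subdiff f x := by
  have key : ∀ z, f z ≠ ⊤ → f x ≤ (((f z).toReal - inner ℝ p (z - x) : ℝ) : EReal) := by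
    intro z hz
    refine EReal.ge_of_forall_gt_iff_ge.1 fun c hc => ?_
    have hzero : Filter.Tendsto (fun i => (inner ℝ (s i) (x - ξ i) : ℝ)) l (nhds 0) := by
      have h0 : Filter.Tendsto (fun i => M * ‖x - ξ i‖) l (nhds 0) := by
        simpa using ((hξ.const_sub x).norm).const_mul M
      refine squeeze_zero_norm (fun i => ?_) h0
      exact (norm_inner_le_norm _ _).trans
        (mul_le_mul_of_nonneg_right (hM i) (norm_nonneg _))
    have ht := ((hp (z - x)).add hzero).const_sub ((f z).toReal)
    rw [add_zero] at ht
    have : c ≤ (f z).toReal - inner ℝ p (z - x) := by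
      refine ge_of_tendsto ht ((hξ.eventually (hf.lsc x _ hc)).mono fun i hi => ?_)
      obtain ⟨hi1, hi2⟩ := hf.mem_subdiff_iff.1 (hs i)
      have hi' : (c : EReal) < f (ξ i) := hi
      rw [← hf.coe_toReal hi1, EReal.coe_lt_coe_iff] at hi'
      have h2 := hi2 z hz
      rw [← inner_add_right, sub_add_sub_cancel]
      linarith
    exact_mod_cast this
  obtain ⟨z, hz⟩ := hf.exists_ne_top
  have hx : f x ≠ ⊤ := ne_top_of_le_ne_top (EReal.coe_ne_top _) (key z hz)
  refine hf.mem_subdiff_iff.2 ⟨hx, fun y hy => ?_⟩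
  have h := key y hy
  rw [← hf.coe_toReal hx, EReal.coe_le_coe_iff] at h
  linarith

theorem IsGammaZero.convex_subdiff (hf : IsGammaZero f) (x : H) : Convex ℝ (subdiff f x) := by
  intro p hp q hq a b ha hb hab
  rw [hf.mem_subdiff_iff] at hp hq ⊢
  refine ⟨hp.1, fun y hy => ?_⟩
  have h1 := mul_le_mul_of_nonneg_left (hp.2 y hy) ha
  have h2 := mul_le_mul_of_nonneg_left (hq.2 y hy) hb
  rw [inner_add_left, real_inner_smul_left, real_inner_smul_left]
  obtain rfl : b = 1 - a := by linarith
  linarith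

theorem IsGammaZero.isClosed_subdiff (hf : IsGammaZero f) (x : H) :
    IsClosed (subdiff f x) := by
  by_cases hx : f x = ⊤
  · have : subdiff f x = ∅ :=
      Set.eq_empty_of_forall_notMem fun p hp => (hf.mem_subdiff_iff.1 hp).1 hx
    rw [this]
    exact isClosed_empty
  · have : subdiff f x = ⋂ y, ⋂ (_ : f y ≠ ⊤),
        {p | (f x).toReal + inner ℝ p (y - x) ≤ (f y).toReal} := by
      ext p
      simp [hf.mem_subdiff_iff, hx]
    rw [this]
    exact isClosed_iInter fun y => isClosed_iInter fun _ =>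
      isClosed_le (by fun_prop) continuous_const

theorem IsGammaZero.minSubgrad_nonempty [CompleteSpace H] (hf : IsGammaZero f) {x : H}
    (hx : (subdiff f x).Nonempty) : (minSubgrad f x).Nonempty := by
  obtain ⟨p, hp, h⟩ := exists_norm_eq_iInf_of_complete_convex hx
    (hf.isClosed_subdiff x).isComplete (hf.convex_subdiff x) 0
  refine ⟨p, hp, fun q hq => ?_⟩
  rw [h]
  exact ciInf_le (f := fun w : subdiff f x => ‖(0 : H) - w‖)
    ⟨0, by rintro _ ⟨w, rfl⟩; exact norm_nonneg _⟩ ⟨q, hq⟩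

/-- A vector `y` that is monotonically related at `x ∈ dom ∂f` to the minimal section of `∂f`
is a subgradient of `f` at `x`.

The points `ξ n` with `w n = y + (n + 1) • (x - ξ n) ∈ ∂f (ξ n)` converge to `x`, and `w n`
converges to the projection `q` of `y` onto `∂f x`. The minimal subgradients `s n` at `ξ n`
have a weak cluster point `p ∈ ∂f x`. Monotone relatedness gives `⟪p - y, q - y⟫ ≤ 0`, whereas
the projection satisfies `‖q - y‖ ^ 2 ≤ ⟪p - y, q - y⟫`; hence `q = y`. -/
theorem IsGammaZero.mem_subdiff_of_forall_minSubgrad [CompleteSpace H] (hf : IsGammaZero f)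
    {x y : H} (hx : (subdiff f x).Nonempty)
    (hy : ∀ ξ, ∀ s ∈ minSubgrad f ξ, 0 ≤ inner ℝ (y - s) (x - ξ)) : y ∈ subdiff f x := by
  have hex : ∀ n : ℕ, ∃ ξ, y + ((n : ℝ) + 1) • (x - ξ) ∈ subdiff f ξ := by
    intro n
    have hn : (0 : ℝ) < (n : ℝ) + 1 := by positivity
    obtain ⟨ξ, h⟩ := hf.exists_smul_sub_mem_subdiff hn (x + ((n : ℝ) + 1)⁻¹ • y)
    refine ⟨ξ, ?_⟩
    rwa [add_sub_right_comm, smul_add, smul_inv_smul₀ hn.ne', add_comm] at h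
  choose ξ hξ using hex
  set w : ℕ → H := fun n => y + ((n : ℝ) + 1) • (x - ξ n) with hw
  have hwy : ∀ n, w n - y = ((n : ℝ) + 1) • (x - ξ n) := fun n => by simp [hw]
  choose s hs using fun n => hf.minSubgrad_nonempty ⟨_, hξ n⟩
  have hwa : ∀ a ∈ subdiff f x, ∀ n, ‖w n - y‖ ≤ ‖a - y‖ := by
    intro a ha n
    have h1 := mul_nonneg (by positivity : (0 : ℝ) ≤ (n : ℝ) + 1)
      (hf.subdiff_monotone ha (hξ n))
    rw [← real_inner_smul_right, ← hwy, show a - (y + (w n - y)) = (a - y) - (w n - y) by abel,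
      inner_sub_left, real_inner_self_eq_norm_sq] at h1
    have h2 := real_inner_le_norm (a - y) (w n - y)
    by_contra! hlt
    nlinarith [norm_nonneg (a - y)]
  obtain ⟨a, ha⟩ := hx
  have hsw : ∀ n, ‖s n‖ ≤ ‖w n‖ := fun n => by
    have h := (hs n).2 _ (hξ n)
    rwa [zero_sub, zero_sub, norm_neg, norm_neg] at h
  have hwM : ∀ n, ‖w n‖ ≤ ‖a - y‖ + ‖y‖ := fun n => by
    have := norm_add_le (w n - y) y
    rw [sub_add_cancel] at this
    linarith [hwa a ha n]
  have hξx : Filter.Tendsto ξ Filter.atTop (nhds x) := by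
    rw [tendsto_iff_norm_sub_tendsto_zero]
    have h0 : Filter.Tendsto (fun n : ℕ => ‖a - y‖ * (1 / ((n : ℝ) + 1))) Filter.atTop
        (nhds 0) := by
      simpa using (tendsto_one_div_add_atTop_nhds_zero_nat (𝕜 := ℝ)).const_mul ‖a - y‖
    refine squeeze_zero (fun _ => norm_nonneg _) (fun n => ?_) h0
    have hn : (0 : ℝ) < (n : ℝ) + 1 := by positivity
    have := hwa a ha n
    rw [hwy, norm_smul, Real.norm_of_nonneg hn.le, norm_sub_rev] at this
    rw [mul_one_div, le_div_iff₀ hn]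
    linarith
  obtain ⟨U, hU⟩ := Filter.exists_ultrafilter_le (Filter.atTop : Filter ℕ)
  have hξU := hξx.mono_left hU
  obtain ⟨q, hq⟩ := exists_weak_limit_of_norm_le U hwM
  obtain ⟨p, hp⟩ := exists_weak_limit_of_norm_le U fun n => (hsw n).trans (hwM n)
  have hqx : q ∈ subdiff f x := hf.mem_subdiff_of_tendsto hξ hwM hξU hq
  have hpx : p ∈ subdiff f x :=
    hf.mem_subdiff_of_tendsto (fun n => (hs n).1) (fun n => (hsw n).trans (hwM n)) hξU hp
  have hqy : Filter.Tendsto (fun n => (inner ℝ (w n - y) (q - y) : ℝ)) U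
      (nhds (‖q - y‖ ^ 2)) := by
    rw [← real_inner_self_eq_norm_sq]
    simpa only [inner_sub_left] using (hq (q - y)).sub_const (inner ℝ y (q - y))
  have hpy : Filter.Tendsto (fun n => (inner ℝ (s n - y) (q - y) : ℝ)) U
      (nhds (inner ℝ (p - y) (q - y))) := by
    simpa only [inner_sub_left] using (hp (q - y)).sub_const (inner ℝ y (q - y))
  have hqmin : ∀ b ∈ subdiff f x, ‖q - y‖ ≤ ‖b - y‖ := by
    intro b hb
    have h1 : ‖q - y‖ ^ 2 ≤ ‖b - y‖ * ‖q - y‖ :=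
      le_of_tendsto hqy (Filter.Eventually.of_forall fun n =>
        (real_inner_le_norm _ _).trans
          (mul_le_mul_of_nonneg_right (hwa b hb n) (norm_nonneg _)))
    by_contra! hlt
    nlinarith [norm_nonneg (b - y)]
  -- Weak convergence without gain of norm is strong convergence.
  have hstrong : Filter.Tendsto (fun n => ‖w n - q‖) U (nhds 0) := by
    have h0 : Filter.Tendsto
        (fun n => 2 * ‖q - y‖ ^ 2 - 2 * (inner ℝ (w n - y) (q - y) : ℝ)) U (nhds 0) := by
      have h := (hqy.const_mul 2).const_sub (2 * ‖q - y‖ ^ 2)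
      rwa [sub_self] at h
    have h1 : Filter.Tendsto (fun n => ‖w n - q‖ ^ 2) U (nhds 0) := by
      refine squeeze_zero (fun _ => by positivity) (fun n => ?_) h0
      have h2 := norm_sub_sq_real (w n - y) (q - y)
      rw [sub_sub_sub_cancel_right] at h2
      have h3 := pow_le_pow_left₀ (norm_nonneg _) (hwa q hqx n) 2
      linarith
    simpa using h1.sqrt
  have hneg : inner ℝ (p - y) (q - y) ≤ 0 := by
    have h0 : Filter.Tendsto (fun n => (‖a - y‖ + ‖y‖ + ‖y‖) * ‖w n - q‖) U (nhds 0) := by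
      simpa using hstrong.const_mul (‖a - y‖ + ‖y‖ + ‖y‖)
    refine le_of_tendsto_of_tendsto' hpy h0 fun n => ?_
    have h1 := mul_nonneg (by positivity : (0 : ℝ) ≤ (n : ℝ) + 1) (hy _ _ (hs n))
    rw [← real_inner_smul_right, ← hwy, ← neg_sub (s n) y, inner_neg_left] at h1
    have h2 : inner ℝ (s n - y) (q - y) =
        inner ℝ (s n - y) (w n - y) - inner ℝ (s n - y) (w n - q) := by
      rw [← inner_sub_right, sub_sub_sub_cancel_left]
    have h3 : -inner ℝ (s n - y) (w n - q) ≤ ‖s n - y‖ * ‖w n - q‖ :=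
      (neg_le_abs _).trans (abs_real_inner_le_norm _ _)
    have h4 : ‖s n - y‖ * ‖w n - q‖ ≤ (‖a - y‖ + ‖y‖ + ‖y‖) * ‖w n - q‖ := by
      refine mul_le_mul_of_nonneg_right ?_ (norm_nonneg _)
      linarith [norm_sub_le (s n) y, hsw n, hwM n]
    linarith
  have hproj : ‖y - q‖ = ⨅ b : subdiff f x, ‖y - b‖ := by
    have : Nonempty (subdiff f x) := ⟨⟨q, hqx⟩⟩
    refine le_antisymm (le_ciInf fun b => ?_)
      (ciInf_le (f := fun b : subdiff f x => ‖y - b‖)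
        ⟨0, by rintro _ ⟨b, rfl⟩; exact norm_nonneg _⟩ ⟨q, hqx⟩)
    rw [norm_sub_rev y q, norm_sub_rev y b]
    exact hqmin b b.2
  have hvar := (norm_eq_iInf_iff_real_inner_le_zero (hf.convex_subdiff x) hqx).1 hproj p hpx
  have h0 : ‖q - y‖ ^ 2 ≤ 0 := by
    rw [← sub_sub_sub_cancel_right p q y, inner_sub_right, ← neg_sub q y, inner_neg_left,
      inner_neg_left, real_inner_self_eq_norm_sq, real_inner_comm] at hvar
    linarith
  have : q = y := by
    simpa [sub_eq_zero] using le_antisymm h0 (by positivity)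
  rwa [← this]

theorem IsGammaZero.subdiff_subset_of_minSubgrad_eq [CompleteSpace H] (hf : IsGammaZero f)
    (hg : IsGammaZero g) (h : ∀ x, minSubgrad f x = minSubgrad g x) (x : H) :
    subdiff g x ⊆ subdiff f x := by
  intro y hy
  obtain ⟨a, ha⟩ := hg.minSubgrad_nonempty ⟨y, hy⟩
  rw [← h x] at ha
  refine hf.mem_subdiff_of_forall_minSubgrad ⟨a, ha.1⟩ fun ξ s hs => ?_
  rw [h ξ] at hs
  exact hg.subdiff_monotone hy hs.1

/-! ### Convex functions with gradients of equal norm -/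

/-- Energy estimate for a discrete descent scheme. With `σ k` the norm of the gradient at the
`k`-th iterate and `d k` the distance of that iterate to a reference point, the series
`∑ h * σ k ^ 2` is summable because `G` is bounded from below; as `σ` is antitone, this forces
`σ N * d N` to become small, so that `F N` is asymptotically at most `A`. -/
theorem descent_energy_estimate {F G σ d : ℕ → ℝ} {h m A : ℝ} (hh : 0 < h)
    (hσ : Antitone σ) (hσ0 : ∀ k, 0 ≤ σ k) (hG : ∀ k, h * σ (k + 1) ^ 2 ≤ G k - G (k + 1))
    (hm : ∀ k, m ≤ G k) (hF : ∀ k, F k - F (k + 1) ≤ h * σ k ^ 2)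
    (hd : ∀ k, d (k + 1) ≤ d k + h * σ k) (hA : ∀ k, F k - A ≤ σ k * d k) :
    F 0 - A ≤ h * σ 0 ^ 2 + (G 0 - m) := by
  set S : ℕ → ℝ := fun n => ∑ k ∈ Finset.range n, h * σ k ^ 2 with hS
  have hSsucc : ∀ n, S (n + 1) = S n + h * σ n ^ 2 := fun n => Finset.sum_range_succ _ _
  have hS0 : S 0 = 0 := Finset.sum_range_zero _
  have hpos : ∀ k, 0 ≤ h * σ k ^ 2 := fun k => by positivity
  have hSle : ∀ n, S n ≤ h * σ 0 ^ 2 + (G 0 - m) := by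
    have hbound : ∀ n, S (n + 1) ≤ h * σ 0 ^ 2 + (G 0 - G n) := by
      intro n
      induction n with
      | zero => simp [hSsucc, hS0]
      | succ n ih => rw [hSsucc]; linarith [hG n]
    intro n
    linarith [hbound n, hSsucc n, hpos n, hm n]
  have hsum : Summable fun k => h * σ k ^ 2 := summable_of_sum_range_le hpos hSle
  have hlim : Filter.Tendsto S Filter.atTop (nhds (∑' k, h * σ k ^ 2)) :=
    hsum.hasSum.tendsto_sum_nat
  have hσlim : Filter.Tendsto σ Filter.atTop (nhds 0) := by
    have h1 : Filter.Tendsto (fun k => σ k ^ 2) Filter.atTop (nhds 0) := by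
      simpa [hh.ne'] using hsum.tendsto_atTop_zero.const_mul h⁻¹
    simpa [Real.sqrt_sq, hσ0] using h1.sqrt
  have hFS : ∀ n, F 0 - F n ≤ S n := by
    intro n
    induction n with
    | zero => simp [hS0]
    | succ n ih => rw [hSsucc]; linarith [hF n]
  -- By monotonicity of `σ`, the increments satisfy `σ N * (h * σ k) ≤ h * σ k ^ 2`, `k ≤ N`.
  have hσd : ∀ M j, σ (M + j) * d (M + j) ≤ σ (M + j) * d M + (S (M + j) - S M) := by
    intro M j
    have hk : ∀ i, i ≤ j →
        σ (M + j) * d (M + i) ≤ σ (M + j) * d M + (S (M + i) - S M) := by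
      intro i
      induction i with
      | zero => simp
      | succ i ih =>
        intro hi
        have h1 := ih (by omega)
        have h2 := mul_le_mul_of_nonneg_left (hd (M + i)) (hσ0 (M + j))
        have h3 := mul_le_mul_of_nonneg_right (hσ (by omega : M + i ≤ M + j))
          (mul_nonneg hh.le (hσ0 (M + i)))
        have h4 := hSsucc (M + i)
        rw [← add_assoc]
        linarith
    exact hk j le_rfl
  have hM : ∀ M, F 0 - A ≤ 2 * (∑' k, h * σ k ^ 2) - S M := by
    intro M
    have ht := ((hσlim.mul_const (d M)).add (hlim.const_mul 2)).sub_const (S M)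
    rw [zero_mul, zero_add] at ht
    refine ge_of_tendsto ht ?_
    filter_upwards [Filter.eventually_ge_atTop M] with N hN
    obtain ⟨j, rfl⟩ := Nat.exists_eq_add_of_le hN
    linarith [hσd M j, hA (M + j), hFS (M + j)]
  have h1 : F 0 - A ≤ 2 * (∑' k, h * σ k ^ 2) - ∑' k, h * σ k ^ 2 :=
    ge_of_tendsto' (hlim.const_sub _) hM
  have h2 : ∑' k, h * σ k ^ 2 ≤ h * σ 0 ^ 2 + (G 0 - m) := le_of_tendsto' hlim hSle
  linarith

/-- If `P` and `Q` are subgradient selections of real convex functions `F` and `G`, with `Q`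
cocoercive, `‖P x‖ = ‖Q x‖` everywhere and `m` a lower bound of `G`, then
`F - inf F ≤ G - m`. The proof runs the gradient descent `u ↦ u - h • Q u`, where `F` decreases by at
most `h * ‖Q u‖ ^ 2` in the step from `u`, `G` by at least this amount in the step that leads to
`u`, and lets `h` tend to `0`. -/
theorem sub_le_sub_of_norm_subgradient_eq {F G : H → ℝ} {P Q : H → H} {m : ℝ}
    (hF : ∀ x y, F x + inner ℝ (P x) (y - x) ≤ F y)
    (hG : ∀ x y, G x + inner ℝ (Q x) (y - x) ≤ G y)
    (hQ : ∀ x y, ‖Q x - Q y‖ ^ 2 ≤ inner ℝ (Q x - Q y) (x - y))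
    (hPQ : ∀ x, ‖P x‖ = ‖Q x‖) (hm : ∀ x, m ≤ G x) (x y : H) : F x - F y ≤ G x - m := by
  have hstep : ∀ h : ℝ, 0 < h → h < 1 → F x - F y ≤ G x - m + h * ‖Q x‖ ^ 2 := by
    intro h h0 h1
    -- Cocoercivity makes the gradient norm decrease in each step, and keeps the angle between
    -- successive gradients small.
    have hsucc : ∀ z, ‖Q (z - h • Q z)‖ ≤ ‖Q z‖ ∧
        ‖Q (z - h • Q z)‖ ^ 2 ≤ inner ℝ (Q (z - h • Q z)) (Q z) := by
      intro z
      set z' := z - h • Q z with hz'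
      have h2 := hQ z z'
      have e := norm_sub_sq_real (Q z) (Q z')
      rw [show z - z' = h • Q z by simp [hz'], real_inner_smul_right, inner_sub_left,
        real_inner_self_eq_norm_sq, e, real_inner_comm] at h2
      rw [real_inner_comm] at e
      have h3 : ‖Q z'‖ ^ 2 ≤ ‖Q z‖ ^ 2 := by
        nlinarith [sq_nonneg ‖Q z - Q z'‖]
      exact ⟨le_of_sq_le_sq h3 (norm_nonneg _), by nlinarith⟩
    set u : ℕ → H := fun n => (fun z => z - h • Q z)^[n] x with hu
    have hus : ∀ n, u (n + 1) = u n - h • Q (u n) := fun n =>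
      Function.iterate_succ_apply' _ _ _
    have := descent_energy_estimate (F := fun n => F (u n)) (G := fun n => G (u n))
      (σ := fun n => ‖Q (u n)‖) (d := fun n => ‖u n - y‖) (A := F y) (m := m) h0
      (antitone_nat_of_succ_le fun n => by rw [hus]; exact (hsucc _).1)
      (fun _ => norm_nonneg _)
      (fun n => by
        have h2 := hG (u (n + 1)) (u n)
        have h3 := mul_le_mul_of_nonneg_left (hsucc (u n)).2 h0.le
        rw [← hus] at h3
        rw [show u n - u (n + 1) = h • Q (u n) by rw [hus]; abel, real_inner_smul_right] at h2
        linarith)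
      (fun _ => hm _)
      (fun n => by
        have h2 := hF (u n) (u (n + 1))
        rw [show u (n + 1) - u n = -(h • Q (u n)) by rw [hus]; abel, inner_neg_right,
          real_inner_smul_right] at h2
        have h3 := mul_le_mul_of_nonneg_left (real_inner_le_norm (P (u n)) (Q (u n))) h0.le
        rw [hPQ, ← sq] at h3
        linarith)
      (fun n => by
        have h2 := norm_sub_le (u n - y) (h • Q (u n))
        rw [norm_smul, Real.norm_of_nonneg h0.le] at h2
        rwa [hus, sub_right_comm])
      (fun n => by
        have h2 := hF (u n) y
        have h3 := real_inner_le_norm (P (u n)) (u n - y)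
        rw [← neg_sub (u n) y, inner_neg_right] at h2
        rw [hPQ] at h3
        linarith)
    simp only [hu, Function.iterate_zero, id] at this
    linarith
  have ht : Filter.Tendsto (fun h : ℝ => G x - m + h * ‖Q x‖ ^ 2)
      (nhdsWithin 0 (Set.Ioi 0)) (nhds (G x - m + 0 * ‖Q x‖ ^ 2)) :=
    ((Filter.tendsto_id.mul_const _).const_add _).mono_left nhdsWithin_le_nhds
  rw [zero_mul, add_zero] at ht
  refine ge_of_tendsto ht ?_
  filter_upwards [Ioo_mem_nhdsGT (zero_lt_one' ℝ)] with h hh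
  exact hstep h hh.1 hh.2

/-- Convex functions differing by a constant have the same gradient; cocoercivity of the
selections replaces differentiability. -/
theorem subgradient_eq_of_eq_add_const {F G : H → ℝ} {P Q : H → H} {c : ℝ}
    (hF : ∀ x y, F x + inner ℝ (P x) (y - x) ≤ F y)
    (hG : ∀ x y, G x + inner ℝ (Q x) (y - x) ≤ G y)
    (hQ : ∀ x y, ‖Q x - Q y‖ ^ 2 ≤ inner ℝ (Q x - Q y) (x - y))
    (hFG : ∀ x, F x = G x + c) (x : H) : P x = Q x := by
  set e := P x - Q x with he
  set y := x + (1 / 2 : ℝ) • e with hy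
  have h1 := hF x y
  have h2 := hG y x
  rw [hFG, hFG] at h1
  have hyx : y - x = (1 / 2 : ℝ) • e := by simp [hy]
  rw [← neg_sub y x, inner_neg_right] at h2
  have h3 : inner ℝ (P x - Q y) (y - x) ≤ 0 := by rw [inner_sub_left]; linarith
  have h4 : ‖Q y - Q x‖ ^ 2 ≤ (1 / 2) * inner ℝ (Q y - Q x) e := by
    have := hQ y x
    rwa [hyx, real_inner_smul_right] at this
  rw [show P x - Q y = e - (Q y - Q x) by rw [he]; abel, hyx, real_inner_smul_right,
    inner_sub_left, real_inner_self_eq_norm_sq] at h3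
  have h5 := real_inner_le_norm (Q y - Q x) e
  have h6 : ‖e‖ ^ 2 = 0 := by
    refine le_antisymm ?_ (by positivity)
    nlinarith [norm_nonneg e, norm_nonneg (Q y - Q x), sq_nonneg (‖Q y - Q x‖ - ‖e‖ / 2)]
  have : e = 0 := by simpa using h6
  exact sub_eq_zero.1 this

/-! ### The potential of the proximal operator -/

/-- The potential `x ↦ ⟪x, p⟫ - ‖p‖ ^ 2 / 2 - f p`, `p = prox f x`, of the proximal operator. It
equals `‖x‖ ^ 2 / 2` minus the Moreau envelope of `f`, and is the Moreau envelope of the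
conjugate of `f`. -/
noncomputable def proxPotential (f : H → EReal) (x : H) : ℝ :=
  inner ℝ x (prox f x) - ‖prox f x‖ ^ 2 / 2 - (f (prox f x)).toReal

variable [CompleteSpace H]

theorem IsGammaZero.prox_ne_top (hf : IsGammaZero f) (x : H) : f (prox f x) ≠ ⊤ :=
  (hf.mem_subdiff_iff.1 (hf.sub_prox_mem_subdiff x)).1

theorem IsGammaZero.le_proxPotential (hf : IsGammaZero f) (x : H) {y : H} (hy : f y ≠ ⊤) :
    inner ℝ x y - ‖y‖ ^ 2 / 2 - (f y).toReal ≤ proxPotential f x := by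
  have h := hf.growth_of_smul_sub_mem_subdiff (c := 1)
    (by simpa using hf.sub_prox_mem_subdiff x) hy
  have h0 : 0 ≤ ‖y - prox f x‖ ^ 2 := by positivity
  rw [norm_sub_sq_real x, norm_sub_sq_real x] at h
  rw [proxPotential]
  linarith

/-- `prox f` is a gradient of the convex function `proxPotential f`. -/
theorem IsGammaZero.proxPotential_add_inner_le (hf : IsGammaZero f) (x y : H) :
    proxPotential f x + inner ℝ (prox f x) (y - x) ≤ proxPotential f y := by
  have h := hf.le_proxPotential y (hf.prox_ne_top x)
  rw [real_inner_comm] at h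
  rw [proxPotential, real_inner_comm, inner_sub_right]
  linarith

theorem IsGammaZero.proxPotential_le_conj (hf : IsGammaZero f) (x : H) :
    (proxPotential f x : EReal) ≤ conj f x := by
  refine le_trans ?_ (le_iSup (fun v : H => ((inner ℝ x v : ℝ) : EReal) - f v) (prox f x))
  rw [← hf.coe_toReal (hf.prox_ne_top x), proxPotential]
  have : 0 ≤ ‖prox f x‖ ^ 2 := by positivity
  norm_cast
  linarith

/-- Fenchel's inequality is an equality for the subgradient `x - prox f x` of `f` at `prox f x`, so
the conjugate takes the value `proxPotential f x - ‖prox f x‖ ^ 2 / 2` there. -/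
theorem IsGammaZero.conj_sub_prox_le (hf : IsGammaZero f) (x : H) :
    conj f (x - prox f x) ≤ proxPotential f x := by
  refine iSup_le fun v => ?_
  by_cases hv : f v = ⊤
  · simp [hv]
  · have h := (hf.mem_subdiff_iff.1 (hf.sub_prox_mem_subdiff x)).2 v hv
    have h0 : 0 ≤ ‖prox f x‖ ^ 2 := by positivity
    rw [inner_sub_right, inner_sub_left _ _ (prox f x), real_inner_self_eq_norm_sq] at h
    rw [← hf.coe_toReal hv, proxPotential]
    norm_cast
    linarith

/-- A conjugate that is bounded from below has the same finite infimum as the potential of the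
proximal operator. -/
theorem IsGammaZero.exists_iInf_conj_eq (hf : IsGammaZero f) (hb : BoundedFromBelow (conj f)) :
    ∃ m : ℝ, (⨅ p, conj f p) = m ∧ (∀ x, m ≤ proxPotential f x) ∧
      ∀ c : ℝ, (∀ x, c ≤ proxPotential f x) → c ≤ m := by
  obtain ⟨b, hb⟩ := hb
  have hbot : (⨅ p, conj f p) ≠ ⊥ :=
    ne_bot_of_le_ne_bot (EReal.coe_ne_bot b) (le_iInf hb)
  have hle : ∀ x, (⨅ p, conj f p) ≤ proxPotential f x := fun x =>
    (iInf_le _ _).trans (hf.conj_sub_prox_le x)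
  have htop : (⨅ p, conj f p) ≠ ⊤ := ne_top_of_le_ne_top (EReal.coe_ne_top _) (hle 0)
  have hcoe := EReal.coe_toReal htop hbot
  refine ⟨_, hcoe.symm, fun x => ?_, fun c hc => ?_⟩
  · have := hle x
    rw [← hcoe] at this
    exact_mod_cast this
  · have : (c : EReal) ≤ ⨅ p, conj f p := le_iInf fun p =>
      (EReal.coe_le_coe_iff.2 (hc p)).trans (hf.proxPotential_le_conj p)
    rw [← hcoe] at this
    exact_mod_cast this

/-! ### Equality up to a constant -/

/-- Every point of the domain is the limit of resolvent values, which lie in the domain of the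
subdifferential and do not increase `f`. -/
theorem IsGammaZero.exists_tendsto_subdiff_nonempty (hf : IsGammaZero f) {x : H}
    (hx : f x ≠ ⊤) :
    ∃ ξ : ℕ → H, Filter.Tendsto ξ Filter.atTop (nhds x) ∧
      ∀ n, (subdiff f (ξ n)).Nonempty ∧ (f (ξ n)).toReal ≤ (f x).toReal := by
  have hc : ∀ n : ℕ, (0 : ℝ) < (n : ℝ) + 1 := fun n => by positivity
  choose ξ hξ using fun n : ℕ => hf.exists_smul_sub_mem_subdiff (hc n) x
  obtain ⟨b, hb, hlow⟩ := hf.exists_linear_lower_bound hx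
  have hgrowth : ∀ n : ℕ,
      (f (ξ n)).toReal + ((n : ℝ) + 1) * ‖ξ n - x‖ ^ 2 ≤ (f x).toReal := fun n => by
    have h := hf.growth_of_smul_sub_mem_subdiff (hξ n) hx
    rw [sub_self, norm_zero, norm_sub_rev x] at h
    linarith
  refine ⟨ξ, ?_, fun n => ⟨⟨_, hξ n⟩, ?_⟩⟩
  · have hsq : ∀ n : ℕ, ‖ξ n - x‖ ^ 2 ≤ (1 + b * (1 + b)) * (1 / ((n : ℝ) + 1)) := by
      intro n
      have h1 := hlow _ (hf.mem_subdiff_iff.1 (hξ n)).1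
      have h2 := hgrowth n
      have h3 : ((n : ℝ) + 1) * ‖ξ n - x‖ ^ 2 ≤ 1 + b * ‖ξ n - x‖ := by linarith
      have h4 : ‖ξ n - x‖ ≤ 1 + b := by
        by_contra! hlt
        have : 0 ≤ (n : ℝ) * ‖ξ n - x‖ ^ 2 := by positivity
        nlinarith
      have h5 := mul_le_mul_of_nonneg_left h4 hb
      rw [mul_one_div, le_div_iff₀ (hc n)]
      linarith
    have h0 : Filter.Tendsto (fun n => ‖ξ n - x‖ ^ 2) Filter.atTop (nhds 0) := by
      refine squeeze_zero (fun _ => by positivity) hsq ?_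
      simpa using (tendsto_one_div_add_atTop_nhds_zero_nat (𝕜 := ℝ)).const_mul
        (1 + b * (1 + b))
    rw [tendsto_iff_norm_sub_tendsto_zero]
    simpa using h0.sqrt
  · have : 0 ≤ ((n : ℝ) + 1) * ‖ξ n - x‖ ^ 2 := by positivity
    linarith [hgrowth n]

theorem IsGammaZero.le_add_const_of_forall_subdiff_nonempty (hf : IsGammaZero f)
    (hg : IsGammaZero g) {c : ℝ}
    (h : ∀ x, (subdiff g x).Nonempty → f x ≤ g x + (c : EReal)) (x : H) :
    f x ≤ g x + (c : EReal) := by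
  by_cases hx : g x = ⊤
  · simp [hx]
  · obtain ⟨ξ, hξ, hξg⟩ := hg.exists_tendsto_subdiff_nonempty hx
    refine le_of_forall_lt fun z hz => ?_
    by_contra! hle
    obtain ⟨n, hn⟩ := (hξ.eventually (hf.lsc x _ (hle.trans_lt hz))).exists
    have hn' : g x + (c : EReal) < f (ξ n) := hn
    obtain ⟨⟨p, hp⟩, hle'⟩ := hξg n
    refine (hn'.trans_le (h _ ⟨p, hp⟩)).not_ge ?_
    rw [← hg.coe_toReal (hg.mem_subdiff_iff.1 hp).1, ← hg.coe_toReal hx]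
    exact_mod_cast add_le_add_left hle' c

theorem IsGammaZero.le_add_const_of_proxPotential_eq (hf : IsGammaZero f) (hg : IsGammaZero g)
    {c : ℝ} (hprox : ∀ x, prox f x = prox g x)
    (h : ∀ x, proxPotential g x = proxPotential f x + c) (x : H) :
    f x ≤ g x + (c : EReal) := by
  refine hf.le_add_const_of_forall_subdiff_nonempty hg (fun y hy => ?_) x
  obtain ⟨p, hp⟩ := hy
  have hpg := hg.mem_subdiff_iff_prox.1 hp
  have hpf := (hprox (y + p)).trans hpg
  have hfy : f y ≠ ⊤ := hpf ▸ hf.prox_ne_top (y + p)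
  have hgy : g y ≠ ⊤ := hpg ▸ hg.prox_ne_top (y + p)
  have h1 := h (y + p)
  rw [proxPotential, proxPotential, hpf, hpg] at h1
  rw [← hf.coe_toReal hfy, ← hg.coe_toReal hgy]
  norm_cast
  linarith

/-- The norms of the proximal points determine a function in `Γ₀(H)` up to a constant: the
potentials, minus their infima, agree, hence so do their gradients `prox f` and `prox g`. -/
theorem IsGammaZero.eq_add_of_norm_prox_eq (hf : IsGammaZero f) (hg : IsGammaZero g)
    (hfb : BoundedFromBelow (conj f)) (hgb : BoundedFromBelow (conj g))
    (h : ∀ x, ‖prox f x‖ = ‖prox g x‖) (x : H) :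
    f x = g x + ((⨅ p, conj g p) - ⨅ p, conj f p) := by
  obtain ⟨m, hm, hmf, hmf'⟩ := hf.exists_iInf_conj_eq hfb
  obtain ⟨k, hk, hkg, hkg'⟩ := hg.exists_iInf_conj_eq hgb
  have hpot : ∀ y, proxPotential f y = proxPotential g y + (m - k) := by
    intro y
    have h1 := hmf' (proxPotential f y - (proxPotential g y - k)) fun z => by
      linarith [sub_le_sub_of_norm_subgradient_eq hf.proxPotential_add_inner_le
        hg.proxPotential_add_inner_le hg.prox_cocoercive h hkg y z]
    have h2 := hkg' (proxPotential g y - (proxPotential f y - m)) fun z => by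
      linarith [sub_le_sub_of_norm_subgradient_eq hg.proxPotential_add_inner_le
        hf.proxPotential_add_inner_le hf.prox_cocoercive (fun x => (h x).symm) hmf y z]
    linarith
  have hprox : ∀ y, prox f y = prox g y :=
    subgradient_eq_of_eq_add_const hf.proxPotential_add_inner_le
      hg.proxPotential_add_inner_le hg.prox_cocoercive hpot
  rw [hm, hk, ← EReal.coe_sub]
  refine le_antisymm (hf.le_add_const_of_proxPotential_eq hg hprox
    (fun y => by rw [hpot]; ring) x) ?_
  have h2 := hg.le_add_const_of_proxPotential_eq hf (c := m - k)
    (fun y => (hprox y).symm) hpot x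
  calc g x + ((k - m : ℝ) : EReal)
      ≤ f x + ((m - k : ℝ) : EReal) + ((k - m : ℝ) : EReal) := add_le_add_left h2 _
    _ = f x := by
      rw [add_assoc, ← EReal.coe_add, sub_add_sub_cancel, sub_self, EReal.coe_zero, add_zero]

end HilbertConvex

theorem mainTheorem1 {H : Type*} [NormedAddCommGroup H] [InnerProductSpace ℝ H] [CompleteSpace H]
    (f g : H → EReal) (hf : HilbertConvex.IsGammaZero f) (hg : HilbertConvex.IsGammaZero g)
    (hf_conj : HilbertConvex.BoundedFromBelow (HilbertConvex.conj f))
    (hg_conj : HilbertConvex.BoundedFromBelow (HilbertConvex.conj g)) :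
    List.TFAE [
      ∀ x : H, ‖HilbertConvex.prox f x‖ = ‖HilbertConvex.prox g x‖,
      ∀ x : H, f x = g x + ((⨅ p : H, HilbertConvex.conj g p) - ⨅ p : H, HilbertConvex.conj f p),
      ∀ x : H, HilbertConvex.minSubgrad f x = HilbertConvex.minSubgrad g x,
      ∀ x : H, HilbertConvex.subdiff f x = HilbertConvex.subdiff g x,
      ∀ x : H, HilbertConvex.prox f x = HilbertConvex.prox g x] := by
  tfae_have 1 → 2 := hf.eq_add_of_norm_prox_eq hg hf_conj hg_conj
  tfae_have 2 → 4 := by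
    obtain ⟨m, hm, -⟩ := hf.exists_iInf_conj_eq hf_conj
    obtain ⟨k, hk, -⟩ := hg.exists_iInf_conj_eq hg_conj
    intro h
    rw [hm, hk, ← EReal.coe_sub] at h
    exact HilbertConvex.subdiff_eq_of_eq_add_const h
  tfae_have 4 → 3 := fun h x => by
    rw [HilbertConvex.minSubgrad, HilbertConvex.minSubgrad, h x]
  tfae_have 3 → 4 := fun h x =>
    (hg.subdiff_subset_of_minSubgrad_eq hf (fun y => (h y).symm) x).antisymm
      (hf.subdiff_subset_of_minSubgrad_eq hg h x)
  tfae_have 4 → 5 := fun h x => by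
    rw [hf.prox_eq_iff, h]
    exact hg.sub_prox_mem_subdiff x
  tfae_have 5 → 1 := fun h x => by rw [h x]
  tfae_finish
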